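/- **Corollary 4.2.** Let $\Gamma=(V,E,s,r)$ be an arbitrary directed graph (sets $V$ of vertices and $E$ of edges, with maps $s,r:E\to V$; no finiteness or countability is assumed) and let $S$ be a commutative semiring with $0$ and $1$. Let $L_S(\Gamma)$ be the Leavitt path algebra of $\Gamma$ with coefficients in $S$, that is, the associative, not necessarily unital, $S$-algebra generated by the disjoint union $V\sqcup E\sqcup E^{*}$, where $E^{*}=\{e^{*}\mid e\in E\}$ is a copy of $E$, subject to the relations 1. $vv'=\delta_{v,v'}v$ for all $v,v'\in V$; 2. $s(e)e=e=e\,r(e)$ and $r(e)e^{*}=e^{*}=e^{*}s(e)$ for all $e\in E$; 3. $e^{*}f=\delta_{e,f}\,r(e)$ for all $e,f\in E$; 4. $v=\sum_{e\in s^{-1}(v)}ee^{*}$ for every $v\in V$ with $0<|s^{-1}(v)|<\infty$. A hemiring (a semiring that need not have an identity element) $R$ is called *congruence-simple* if the diagonal congruence $\{(a,a)\mid a\in R\}$ and the universal congruence $R\times R$ are the only congruences on $R$, a congruence being an equivalence relation compatible with addition and multiplication; and *ideal-simple* if $\{0\}$ and $R$ are the only ideals of $R$, an ideal being a submonoid $I$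 of $(R,+,0)$ with $xa,ax\in I$ for all $a\in I$, $x\in R$. If $L_S(\Gamma)$ is congruence-simple, then $L_S(\Gamma)$ is ideal-simple. -/

import Mathlib

/-! Leavitt path algebras with coefficients in a commutative semiring, and simplicity of hemirings.
A hemiring (an additively commutative semiring with `0`, not necessarily with `1`) is Mathlib's
`NonUnitalSemiring`. -/

/-- A directed graph with vertex set `V` and edge set `E`; loops, multiple edges and vertices
emitting infinitely many edges are allowed. -/
structure DirGraph (V : Type*) (E : Type*) where
  /-- the source map -/
  s : E → V
  /-- the range map -/
  r : E → V

namespace DirGraph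

variable {V : Type*} {E : Type*} (Γ : DirGraph V E)

/-- A vertex is regular if the set of edges it emits is finite and nonempty. -/
def IsRegular (v : V) : Prop :=
  {e : E | Γ.s e = v}.Finite ∧ {e : E | Γ.s e = v}.Nonempty

end DirGraph

namespace LeavittPath

/-- The generators of the Leavitt path algebra: the disjoint union of `V`, `E` and a copy `E*`
of `E` (the ghost edges). -/
inductive Gen (V : Type*) (E : Type*) where
  | vertex (v : V) : Gen V E
  | edge (e : E) : Gen V E
  | ghost (e : E) : Gen V E

/-- The free (associative, not necessarily unital) `S`-algebra on the generators: the semigroup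
algebra over `S` of the free semigroup of nonempty words in the generators. It has no constant
terms. -/
abbrev FreeAlg (S : Type*) [CommSemiring S] (V : Type*) (E : Type*) :=
  MonoidAlgebra S (FreeSemigroup (Gen V E))

section

variable (S : Type*) [CommSemiring S] {V : Type*} {E : Type*}

/-- The vertex `v` as an element of the free algebra. -/
noncomputable def vtx (v : V) : FreeAlg S V E :=
  MonoidAlgebra.single (FreeSemigroup.of (Gen.vertex v)) 1

/-- The edge `e` as an element of the free algebra. -/
noncomputable def edg (e : E) : FreeAlg S V E :=
  MonoidAlgebra.single (FreeSemigroup.of (Gen.edge e)) 1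

/-- The ghost edge `e*` as an element of the free algebra. -/
noncomputable def gst (e : E) : FreeAlg S V E :=
  MonoidAlgebra.single (FreeSemigroup.of (Gen.ghost e)) 1

/-- The defining relations of the Leavitt path algebra. -/
inductive Rel (Γ : DirGraph V E) : FreeAlg S V E → FreeAlg S V E → Prop
  | vertex_idem (v : V) : Rel Γ (vtx S v * vtx S v) (vtx S v)
  | vertex_orth (v w : V) (h : v ≠ w) : Rel Γ (vtx S v * vtx S w) 0
  | source_edge (e : E) : Rel Γ (vtx S (Γ.s e) * edg S e) (edg S e)
  | edge_range (e : E) : Rel Γ (edg S e * vtx S (Γ.r e)) (edg S e)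
  | range_ghost (e : E) : Rel Γ (vtx S (Γ.r e) * gst S e) (gst S e)
  | ghost_source (e : E) : Rel Γ (gst S e * vtx S (Γ.s e)) (gst S e)
  | ghost_edge_self (e : E) : Rel Γ (gst S e * edg S e) (vtx S (Γ.r e))
  | ghost_edge_ne (e f : E) (h : e ≠ f) : Rel Γ (gst S e * edg S f) 0
  | regular (v : V) (h : Γ.IsRegular v) :
      Rel Γ (vtx S v) (∑ e ∈ h.1.toFinset, edg S e * gst S e)

/-- The smallest `S`-algebra congruence on the free algebra that contains the defining
relations. Closure under scalars is a separate clause because the free algebra has no identity. -/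
inductive ConRel (Γ : DirGraph V E) : FreeAlg S V E → FreeAlg S V E → Prop
  | of {x y} : Rel S Γ x y → ConRel Γ x y
  | refl (x) : ConRel Γ x x
  | symm {x y} : ConRel Γ x y → ConRel Γ y x
  | trans {x y z} : ConRel Γ x y → ConRel Γ y z → ConRel Γ x z
  | add {w x y z} : ConRel Γ w x → ConRel Γ y z → ConRel Γ (w + y) (x + z)
  | mul {w x y z} : ConRel Γ w x → ConRel Γ y z → ConRel Γ (w * y) (x * z)
  | smul (c : S) {x y} : ConRel Γ x y → ConRel Γ (c • x) (c • y)

/-- `ConRel` as a bundled congruence. -/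
def con (Γ : DirGraph V E) : RingCon (FreeAlg S V E) where
  r := ConRel S Γ
  iseqv := ⟨ConRel.refl, ConRel.symm, ConRel.trans⟩
  add' := ConRel.add
  mul' := ConRel.mul

end

end LeavittPath

/-- The Leavitt path algebra `L_S(Γ)`: the (not necessarily unital) `S`-algebra generated by
`V`, `E` and `E*` subject to the defining relations. -/
def LeavittPathAlgebra (S : Type*) [CommSemiring S] {V : Type*} {E : Type*} (Γ : DirGraph V E) :=
  (LeavittPath.con S Γ).Quotient

namespace LeavittPathAlgebra

variable {S : Type*} [CommSemiring S] {V : Type*} {E : Type*} {Γ : DirGraph V E}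

noncomputable instance instNonUnitalSemiring : NonUnitalSemiring (LeavittPathAlgebra S Γ) :=
  inferInstanceAs (NonUnitalSemiring (LeavittPath.con S Γ).Quotient)

noncomputable instance instSMul : SMul S (LeavittPathAlgebra S Γ) where
  smul c := Quotient.map' (c • ·) fun _ _ h => LeavittPath.ConRel.smul c h

/-- The `S`-semimodule structure of `L_S(Γ)`. -/
noncomputable instance instModule : Module S (LeavittPathAlgebra S Γ) where
  one_smul := by rintro ⟨x⟩; exact congrArg (Quotient.mk'') (one_smul S x)
  mul_smul a b := by rintro ⟨x⟩; exact congrArg (Quotient.mk'') (mul_smul a b x)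
  smul_zero a := congrArg (Quotient.mk'') (smul_zero a)
  smul_add a := by rintro ⟨x⟩ ⟨y⟩; exact congrArg (Quotient.mk'') (smul_add a x y)
  add_smul a b := by rintro ⟨x⟩; exact congrArg (Quotient.mk'') (add_smul a b x)
  zero_smul := by rintro ⟨x⟩; exact congrArg (Quotient.mk'') (zero_smul S x)

instance instIsScalarTower :
    IsScalarTower S (LeavittPathAlgebra S Γ) (LeavittPathAlgebra S Γ) where
  smul_assoc a := by rintro ⟨x⟩ ⟨y⟩; exact congrArg (Quotient.mk'') (smul_mul_assoc a x y)

instance instSMulCommClass :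
    SMulCommClass S (LeavittPathAlgebra S Γ) (LeavittPathAlgebra S Γ) where
  smul_comm a := by rintro ⟨x⟩ ⟨y⟩; exact congrArg (Quotient.mk'') (mul_smul_comm a x y).symm

end LeavittPathAlgebra

/-- A hemiring is congruence-simple if the diagonal congruence `⊥` and the universal congruence
`⊤` are its only congruences. -/
def IsCongruenceSimple (R : Type*) [NonUnitalSemiring R] : Prop :=
  ∀ c : RingCon R, c = ⊥ ∨ c = ⊤

/-- A hemiring is ideal-simple if `0` and the whole hemiring are its only (two-sided) ideals, an
ideal being an additive submonoid closed under multiplication by arbitrary elements on either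
side. -/
def IsIdealSimple (R : Type*) [NonUnitalSemiring R] : Prop :=
  ∀ I : AddSubmonoid R, (∀ a ∈ I, ∀ x : R, x * a ∈ I ∧ a * x ∈ I) → I = ⊥ ∨ I = ⊤

/-! Let `I` be a nonzero ideal. Its Bourne congruence identifies some nonzero element with `0`, so
it is universal: every `x` satisfies `x + b = c` with `b, c ∈ I`. Applied to the ideal of additively
invertible elements, the same argument shows that either every element has a negative or a sum
vanishes only if its summands do. In the first case the equation for a vertex puts that vertex into
`I`.

In the zero-sum-free case, elements with the same nonzero two-sided multiples are equal. Hence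
addition is idempotent and nonzero scalars act as the identity, so every element is a plain sum of
monomials `p q*`. Multiplying a nonzero element of `I` by suitable paths gives a vertex plus
nonempty closed paths (`exists_closed_paths_mem`). Conjugation `x ↦ t* x t` removes these one at a
time (`exists_vert_mem_of_add_sum_mem`), provided that each closed path `c` has a `t` with `t* c t =
0`. This can fail only if the graph never branches after the base vertex `w`; then `c` and `w` act
alike on functions on boundary paths, and faithfulness of the action would force `c = w`, which a
`ℤ`-grading excludes. Finally, the action on boundary paths that avoid the vertices of `I` shows
that `I` contains all vertices (`forall_vert_mem`). -/

namespace DirGraph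

variable {V : Type*} {E : Type*} (Γ : DirGraph V E)

/-- `Γ.IsPath u l v` says that the list of edges `l` is a path from `u` to `v`. -/
def IsPath : V → List E → V → Prop
  | u, [], v => u = v
  | u, e :: l, v => Γ.s e = u ∧ IsPath (Γ.r e) l v

variable {Γ}

theorem IsPath.append {u v w : V} {l m : List E} (h : Γ.IsPath u l v) (h' : Γ.IsPath v m w) :
    Γ.IsPath u (l ++ m) w := by
  induction l generalizing u with
  | nil => cases h; exact h'
  | cons e l ih => exact ⟨h.1, ih h.2⟩

end DirGraph

/-! ### Multiplication of paths, ghost paths and monomials `p q*`. -/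

namespace LeavittPathAlgebra

open LeavittPath

variable {S : Type*} [CommSemiring S] {V : Type*} {E : Type*} {Γ : DirGraph V E}

variable (S Γ) in
/-- The quotient map from the free algebra. -/
def mk (x : FreeAlg S V E) : LeavittPathAlgebra S Γ := Quotient.mk'' x

theorem mk_mul (x y : FreeAlg S V E) : mk S Γ (x * y) = mk S Γ x * mk S Γ y := rfl

theorem mk_add (x y : FreeAlg S V E) : mk S Γ (x + y) = mk S Γ x + mk S Γ y := rfl

theorem mk_smul (c : S) (x : FreeAlg S V E) : mk S Γ (c • x) = c • mk S Γ x := rfl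

theorem mk_zero : mk S Γ 0 = 0 := rfl

theorem mk_sum {ι : Type*} (s : Finset ι) (f : ι → FreeAlg S V E) :
    mk S Γ (∑ i ∈ s, f i) = ∑ i ∈ s, mk S Γ (f i) := by
  classical
  induction s using Finset.induction_on with
  | empty => rfl
  | insert a s ha ih => rw [Finset.sum_insert ha, Finset.sum_insert ha, mk_add, ih]

theorem mk_eq {x y : FreeAlg S V E} (h : Rel S Γ x y) : mk S Γ x = mk S Γ y :=
  Quotient.sound' (ConRel.of h)

variable (S Γ) in
/-- The vertex `v` in the Leavitt path algebra. -/
noncomputable def vert (v : V) : LeavittPathAlgebra S Γ := mk S Γ (vtx S v)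

variable (S Γ) in
/-- The edge `e` in the Leavitt path algebra. -/
noncomputable def edge (e : E) : LeavittPathAlgebra S Γ := mk S Γ (edg S e)

variable (S Γ) in
/-- The ghost edge `e*` in the Leavitt path algebra. -/
noncomputable def ghost (e : E) : LeavittPathAlgebra S Γ := mk S Γ (gst S e)

@[simp] theorem vert_mul_self (v : V) : vert S Γ v * vert S Γ v = vert S Γ v :=
  mk_eq (.vertex_idem v)

theorem vert_mul_ne {v w : V} (h : v ≠ w) : vert S Γ v * vert S Γ w = 0 :=
  mk_eq (.vertex_orth v w h)

@[simp] theorem source_mul_edge (e : E) : vert S Γ (Γ.s e) * edge S Γ e = edge S Γ e :=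
  mk_eq (.source_edge e)

@[simp] theorem edge_mul_range (e : E) : edge S Γ e * vert S Γ (Γ.r e) = edge S Γ e :=
  mk_eq (.edge_range e)

@[simp] theorem range_mul_ghost (e : E) : vert S Γ (Γ.r e) * ghost S Γ e = ghost S Γ e :=
  mk_eq (.range_ghost e)

@[simp] theorem ghost_mul_source (e : E) : ghost S Γ e * vert S Γ (Γ.s e) = ghost S Γ e :=
  mk_eq (.ghost_source e)

@[simp] theorem ghost_mul_edge_self (e : E) : ghost S Γ e * edge S Γ e = vert S Γ (Γ.r e) :=
  mk_eq (.ghost_edge_self e)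

theorem ghost_mul_edge_ne {e f : E} (h : e ≠ f) : ghost S Γ e * edge S Γ f = 0 :=
  mk_eq (.ghost_edge_ne e f h)

theorem vert_eq_sum {v : V} (h : Γ.IsRegular v) :
    vert S Γ v = ∑ e ∈ h.1.toFinset, edge S Γ e * ghost S Γ e :=
  (mk_eq (.regular v h)).trans (mk_sum _ _)

variable (S Γ) in
/-- The product of the edges in `l` followed by the vertex `v`. -/
noncomputable def real (l : List E) (v : V) : LeavittPathAlgebra S Γ :=
  l.foldr (fun e x => edge S Γ e * x) (vert S Γ v)

variable (S Γ) in
/-- The vertex `v` followed by the product of the ghosts of the edges in `l` in reverse order. -/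
noncomputable def imag (l : List E) (v : V) : LeavittPathAlgebra S Γ :=
  l.foldr (fun e x => x * ghost S Γ e) (vert S Γ v)

@[simp] theorem real_nil (v : V) : real S Γ [] v = vert S Γ v := rfl

@[simp] theorem real_cons (e : E) (l : List E) (v : V) :
    real S Γ (e :: l) v = edge S Γ e * real S Γ l v := rfl

@[simp] theorem imag_nil (v : V) : imag S Γ [] v = vert S Γ v := rfl

@[simp] theorem imag_cons (e : E) (l : List E) (v : V) :
    imag S Γ (e :: l) v = imag S Γ l v * ghost S Γ e := rfl

@[simp] theorem real_mul_vert (l : List E) (v : V) :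
    real S Γ l v * vert S Γ v = real S Γ l v := by
  induction l with
  | nil => simp
  | cons e l ih => rw [real_cons, mul_assoc, ih]

@[simp] theorem vert_mul_imag (l : List E) (v : V) :
    vert S Γ v * imag S Γ l v = imag S Γ l v := by
  induction l with
  | nil => simp
  | cons e l ih => rw [imag_cons, ← mul_assoc, ih]

theorem vert_mul_real {u v : V} {l : List E} (h : Γ.IsPath u l v) :
    vert S Γ u * real S Γ l v = real S Γ l v := by
  cases l with
  | nil => cases h; simp
  | cons e l => rw [real_cons, ← mul_assoc, ← h.1, source_mul_edge]

theorem vert_mul_real_ne {u v w : V} {l : List E} (h : Γ.IsPath u l v) (hw : w ≠ u) :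
    vert S Γ w * real S Γ l v = 0 := by
  rw [← vert_mul_real h, ← mul_assoc, vert_mul_ne hw, zero_mul]

theorem imag_mul_vert {u v : V} {l : List E} (h : Γ.IsPath u l v) :
    imag S Γ l v * vert S Γ u = imag S Γ l v := by
  cases l with
  | nil => cases h; simp
  | cons e l => rw [imag_cons, mul_assoc, ← h.1, ghost_mul_source]

theorem real_mul_real {v w : V} (l : List E) {m : List E} (h : Γ.IsPath v m w) :
    real S Γ l v * real S Γ m w = real S Γ (l ++ m) w := by
  induction l with
  | nil => exact vert_mul_real h
  | cons e l ih => rw [real_cons, mul_assoc, ih, List.cons_append, real_cons]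

theorem ghost_mul_imag (e : E) (l : List E) :
    ghost S Γ e * imag S Γ l (Γ.s e) = imag S Γ (l ++ [e]) (Γ.r e) := by
  induction l with
  | nil => simp
  | cons f l ih => rw [imag_cons, ← mul_assoc, ih, List.cons_append, imag_cons]

theorem imag_mul_real_append {u v w : V} {l m : List E} (h : Γ.IsPath u l v)
    (h' : Γ.IsPath v m w) : imag S Γ l v * real S Γ (l ++ m) w = real S Γ m w := by
  induction l generalizing u with
  | nil => exact vert_mul_real h'
  | cons e l ih =>
    rw [imag_cons, List.cons_append, real_cons, mul_assoc, ← mul_assoc (ghost S Γ e),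
      ghost_mul_edge_self, vert_mul_real (h.2.append h'), ih h.2]

theorem imag_mul_real_self {u v : V} {l : List E} (h : Γ.IsPath u l v) :
    imag S Γ l v * real S Γ l v = vert S Γ v := by
  have := imag_mul_real_append (S := S) h (show Γ.IsPath v [] v from rfl)
  rwa [List.append_nil] at this

/-- Cancel first edges by `e* f = δ r(e)`. The product survives only if `l` is an initial segment of
`m`, and the length bound ensures that no ghost edge is left over. -/
theorem imag_mul_real {u u' v w : V} {l m : List E} (h : Γ.IsPath u l v)
    (h' : Γ.IsPath u' m w) (hl : l.length ≤ m.length) :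
    imag S Γ l v * real S Γ m w = 0 ∨ ∃ d, m = l ++ d ∧ Γ.IsPath v d w ∧
      imag S Γ l v * real S Γ m w = real S Γ d w := by
  induction l generalizing u u' m with
  | nil =>
    by_cases huv : v = u'
    · subst huv
      exact .inr ⟨m, rfl, h', vert_mul_real h'⟩
    · exact .inl (vert_mul_real_ne h' huv)
  | cons e l ih =>
    cases m with
    | nil => simp at hl
    | cons f m =>
      by_cases hef : e = f
      · subst hef
        have key : imag S Γ (e :: l) v * real S Γ (e :: m) w = imag S Γ l v * real S Γ m w := by
          rw [imag_cons, real_cons, mul_assoc, ← mul_assoc (ghost S Γ e), ghost_mul_edge_self,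
            vert_mul_real h'.2]
        rw [key]
        refine (ih h.2 h'.2 (by simpa using hl)).imp_right ?_
        rintro ⟨d, rfl, hd, hd'⟩
        exact ⟨d, rfl, hd, hd'⟩
      · left
        rw [imag_cons, real_cons, mul_assoc, ← mul_assoc (ghost S Γ e), ghost_mul_edge_ne hef,
          zero_mul, mul_zero]

variable (S Γ) in
/-- The monomials `p q*` with `p` and `q` paths that have the same end. -/
def monomials : Set (LeavittPathAlgebra S Γ) :=
  {x | ∃ u u' v p q, Γ.IsPath u p v ∧ Γ.IsPath u' q v ∧ x = real S Γ p v * imag S Γ q v}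

theorem vert_mem_monomials (v : V) : vert S Γ v ∈ monomials S Γ :=
  ⟨v, v, v, [], [], rfl, rfl, by simp⟩

theorem edge_mem_monomials (e : E) : edge S Γ e ∈ monomials S Γ :=
  ⟨Γ.s e, Γ.r e, Γ.r e, [e], [], ⟨rfl, rfl⟩, rfl, by simp⟩

theorem ghost_mem_monomials (e : E) : ghost S Γ e ∈ monomials S Γ :=
  ⟨Γ.r e, Γ.s e, Γ.r e, [], [e], rfl, ⟨rfl, rfl⟩, by simp⟩

theorem vert_mul_monomial (w : V) {x : LeavittPathAlgebra S Γ} (hx : x ∈ monomials S Γ) :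
    vert S Γ w * x = 0 ∨ vert S Γ w * x ∈ monomials S Γ := by
  obtain ⟨u, u', v, p, q, hp, hq, rfl⟩ := hx
  rw [← mul_assoc]
  by_cases h : w = u
  · subst h
    exact .inr ⟨w, u', v, p, q, hp, hq, by rw [vert_mul_real hp]⟩
  · exact .inl (by rw [vert_mul_real_ne hp h, zero_mul])

theorem edge_mul_monomial (e : E) {x : LeavittPathAlgebra S Γ} (hx : x ∈ monomials S Γ) :
    edge S Γ e * x = 0 ∨ edge S Γ e * x ∈ monomials S Γ := by
  obtain ⟨u, u', v, p, q, hp, hq, rfl⟩ := hx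
  by_cases h : Γ.r e = u
  · exact .inr ⟨Γ.s e, u', v, e :: p, q, ⟨rfl, h ▸ hp⟩, hq, by rw [real_cons, mul_assoc]⟩
  · left
    rw [← edge_mul_range, ← mul_assoc, mul_assoc (edge S Γ e), vert_mul_real_ne hp h, mul_zero,
      zero_mul]

theorem ghost_mul_monomial (e : E) {x : LeavittPathAlgebra S Γ} (hx : x ∈ monomials S Γ) :
    ghost S Γ e * x = 0 ∨ ghost S Γ e * x ∈ monomials S Γ := by
  obtain ⟨u, u', v, p, q, hp, hq, rfl⟩ := hx
  cases p with
  | nil =>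
    rw [real_nil, vert_mul_imag]
    by_cases h : Γ.s e = v
    · subst h
      refine .inr ⟨Γ.r e, u', Γ.r e, [], q ++ [e], rfl, hq.append ⟨rfl, rfl⟩, ?_⟩
      rw [real_nil, vert_mul_imag, ghost_mul_imag]
    · left
      rw [← ghost_mul_source, ← vert_mul_imag, ← mul_assoc, mul_assoc (ghost S Γ e), vert_mul_ne h,
        mul_zero, zero_mul]
  | cons f p =>
    rw [real_cons, ← mul_assoc, ← mul_assoc]
    by_cases h : e = f
    · subst h
      exact .inr ⟨Γ.r e, u', v, p, q, hp.2, hq,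
        by rw [ghost_mul_edge_self, vert_mul_real hp.2]⟩
    · exact .inl (by rw [ghost_mul_edge_ne h, zero_mul, zero_mul])

variable (S Γ) in
/-- The image of a generator. -/
noncomputable def gen (g : Gen V E) : LeavittPathAlgebra S Γ :=
  mk S Γ (MonoidAlgebra.single (FreeSemigroup.of g) 1)

theorem gen_mem_monomials (g : Gen V E) : gen S Γ g ∈ monomials S Γ := by
  cases g with
  | vertex v => exact vert_mem_monomials v
  | edge e => exact edge_mem_monomials e
  | ghost e => exact ghost_mem_monomials e

theorem gen_mul_monomial (g : Gen V E) {x : LeavittPathAlgebra S Γ} (hx : x ∈ monomials S Γ) :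
    gen S Γ g * x = 0 ∨ gen S Γ g * x ∈ monomials S Γ := by
  cases g with
  | vertex v => exact vert_mul_monomial v hx
  | edge e => exact edge_mul_monomial e hx
  | ghost e => exact ghost_mul_monomial e hx

theorem word_mem_monomials (w : FreeSemigroup (Gen V E)) :
    mk S Γ (MonoidAlgebra.single w 1) = 0 ∨
      mk S Γ (MonoidAlgebra.single w 1) ∈ monomials S Γ := by
  induction w using FreeSemigroup.recOnMul with
  | ih1 g => exact .inr (gen_mem_monomials g)
  | ih2 g w _ ih =>
    have : mk S Γ (MonoidAlgebra.single (FreeSemigroup.of g * w) 1) =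
        gen S Γ g * mk S Γ (MonoidAlgebra.single w 1) := by
      rw [gen, ← mk_mul, MonoidAlgebra.single_mul_single, one_mul]
    rw [this]
    rcases ih with ih | ih
    · exact .inl (by rw [ih, mul_zero])
    · exact gen_mul_monomial g ih

theorem span_monomials : Submodule.span S (monomials S Γ) = ⊤ := by
  refine eq_top_iff.2 fun x _ => ?_
  obtain ⟨x, rfl⟩ : ∃ y, mk S Γ y = x := Quotient.exists_rep x
  induction x using MonoidAlgebra.induction_linear with
  | zero => rw [mk_zero]; exact zero_mem _
  | add f g hf hg => rw [mk_add]; exact add_mem (hf trivial) (hg trivial)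
  | single w c =>
    rw [← mul_one c, ← smul_eq_mul, ← MonoidAlgebra.smul_single, mk_smul]
    refine Submodule.smul_mem _ _ ?_
    rcases word_mem_monomials (S := S) (Γ := Γ) w with h | h
    · rw [h]; exact zero_mem _
    · exact Submodule.subset_span h

end LeavittPathAlgebra

/-! ### Congruences on hemirings and consequences of congruence-simplicity. -/

section CongruenceSimple

variable {R : Type*} [NonUnitalSemiring R]

/-- The Bourne congruence of an ideal. -/
def bourneCon (I : AddSubmonoid R) (hI : ∀ a ∈ I, ∀ x : R, x * a ∈ I ∧ a * x ∈ I) :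
    RingCon R where
  r x y := ∃ a ∈ I, ∃ b ∈ I, x + a = y + b
  iseqv := by
    refine ⟨fun x => ⟨0, I.zero_mem, 0, I.zero_mem, rfl⟩, ?_, ?_⟩
    · rintro x y ⟨a, ha, b, hb, h⟩
      exact ⟨b, hb, a, ha, h.symm⟩
    · rintro x y z ⟨a, ha, b, hb, h⟩ ⟨c, hc, d, hd, h'⟩
      refine ⟨a + c, add_mem ha hc, b + d, add_mem hb hd, ?_⟩
      rw [← add_assoc, h, add_right_comm, h', add_assoc, add_comm d b]
  add' := by
    rintro w x y z ⟨a, ha, b, hb, h⟩ ⟨c, hc, d, hd, h'⟩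
    exact ⟨a + c, add_mem ha hc, b + d, add_mem hb hd,
      by rw [add_add_add_comm, h, h', add_add_add_comm]⟩
  mul' := by
    rintro w x y z ⟨a, ha, b, hb, h⟩ ⟨c, hc, d, hd, h'⟩
    refine ⟨a * (y + c) + w * c, add_mem (hI a ha _).2 (hI c hc _).1,
      b * (z + d) + x * d, add_mem (hI b hb _).2 (hI d hd _).1, ?_⟩
    -- All terms other than `w * y` and `x * z` in these equal products lie in `I`.
    have h1 : (w + a) * (y + c) = (x + b) * (z + d) := by rw [h, h']
    have h2 : ∀ w a y c : R, (w + a) * (y + c) = w * y + (a * (y + c) + w * c) := by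
      intro w a y c
      rw [add_mul, mul_add w, add_assoc, add_comm (w * c)]
    rwa [h2, h2] at h1

/-- The relation of having the same nonzero two-sided multiples, for a hemiring in which a sum
vanishes only if both summands do. -/
def annihilatorCon (hR : ∀ x y : R, x + y = 0 → x = 0) : RingCon R where
  r x y := ∀ u v, u * x * v = 0 ↔ u * y * v = 0
  iseqv := ⟨fun _ _ _ => Iff.rfl, fun h u v => (h u v).symm,
    fun h h' u v => (h u v).trans (h' u v)⟩
  add' := by
    intro w x y z h h'
    have key : ∀ a b u v : R, u * (a + b) * v = 0 ↔ u * a * v = 0 ∧ u * b * v = 0 := by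
      intro a b u v
      rw [mul_add, add_mul]
      refine ⟨fun H => ⟨hR _ _ H, hR _ _ (add_comm (u * a * v) _ ▸ H)⟩, ?_⟩
      rintro ⟨h1, h2⟩
      rw [h1, h2, add_zero]
    intro u v
    rw [key, key, h, h']
  mul' := by
    intro w x y z h h' u v
    have h1 := h u (y * v)
    have h2 := h' (u * x) v
    simp only [mul_assoc] at h1 h2 ⊢
    exact h1.trans h2

theorem ringCon_eq_of_eq_bot {c : RingCon R} (h : c = ⊥) {x y : R} (hxy : c x y) : x = y := by
  subst h; exact hxy

theorem ringCon_rel_of_eq_top {c : RingCon R} (h : c = ⊤) (x y : R) : c x y := by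
  subst h; trivial

theorem IsCongruenceSimple.exists_add_eq (h : IsCongruenceSimple R) {I : AddSubmonoid R}
    (hI : ∀ a ∈ I, ∀ x : R, x * a ∈ I ∧ a * x ∈ I) {a : R} (ha : a ∈ I) (ha0 : a ≠ 0) (x : R) :
    ∃ b ∈ I, ∃ c ∈ I, x + b = c := by
  rcases h (bourneCon I hI) with h | h
  · exact absurd (ringCon_eq_of_eq_bot h (x := a) (y := 0)
      ⟨0, I.zero_mem, a, ha, by rw [add_zero, zero_add]⟩) ha0
  · obtain ⟨b, hb, c, hc, e⟩ := ringCon_rel_of_eq_top h x 0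
    exact ⟨b, hb, c, hc, by rw [e, zero_add]⟩

variable (R) in
/-- The ideal of additively invertible elements. -/
def addInvertible : AddSubmonoid R where
  carrier := {x | ∃ y, x + y = 0}
  zero_mem' := ⟨0, add_zero 0⟩
  add_mem' := by
    rintro a b ⟨c, hc⟩ ⟨d, hd⟩
    exact ⟨c + d, by rw [add_add_add_comm, hc, hd, add_zero]⟩

/-- If the ideal of additively invertible elements is nonzero, then every `x` satisfies `x + c = d`
with `d` invertible, so `x` is invertible too. -/
theorem IsCongruenceSimple.zeroSumFree_or_exists_neg (h : IsCongruenceSimple R) :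
    (∀ x y : R, x + y = 0 → x = 0) ∨ ∀ x : R, ∃ y, x + y = 0 := by
  refine or_iff_not_imp_left.2 fun H x => ?_
  push Not at H
  obtain ⟨a, b, hab, ha⟩ := H
  obtain ⟨c, -, d, ⟨e, he⟩, hd⟩ := h.exists_add_eq (I := addInvertible R) (by
    rintro a ⟨b, hb⟩ x
    exact ⟨⟨x * b, by rw [← mul_add, hb, mul_zero]⟩, ⟨b * x, by rw [← add_mul, hb, zero_mul]⟩⟩)
    ⟨b, hab⟩ ha x
  exact ⟨c + e, by rw [← add_assoc, hd, he]⟩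

/-- The nonzero idempotent `p` is not related to `0`, since `p * p * p ≠ 0`; so `annihilatorCon` is
not universal. -/
theorem IsCongruenceSimple.eq_of_annihilator (h : IsCongruenceSimple R)
    (hR : ∀ x y : R, x + y = 0 → x = 0) {p : R} (hp : p * p = p) (hp0 : p ≠ 0) {x y : R}
    (hxy : ∀ u v, u * x * v = 0 ↔ u * y * v = 0) : x = y := by
  rcases h (annihilatorCon hR) with h | h
  · exact ringCon_eq_of_eq_bot h hxy
  · have := ((ringCon_rel_of_eq_top h p 0) p p).2 (by rw [mul_zero, zero_mul])
    rw [hp, hp] at this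
    exact absurd this hp0

theorem IsCongruenceSimple.add_self (h : IsCongruenceSimple R)
    (hR : ∀ x y : R, x + y = 0 → x = 0) {p : R} (hp : p * p = p) (hp0 : p ≠ 0) (x : R) :
    x + x = x := by
  refine h.eq_of_annihilator hR hp hp0 fun u v => ?_
  rw [mul_add, add_mul]
  exact ⟨fun H => hR _ _ H, fun H => by rw [H, add_zero]⟩

/-- The congruence of having the same multiple by a scalar. -/
def smulCon {S : Type*} [CommSemiring S] [Module S R] [IsScalarTower S R R] [SMulCommClass S R R]
    (s : S) : RingCon R where
  r x y := s • x = s • y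
  iseqv := ⟨fun _ => rfl, Eq.symm, Eq.trans⟩
  add' h h' := by rw [smul_add, h, h', smul_add]
  mul' {w x y z} h h' := by
    rw [← smul_mul_assoc, h, smul_mul_assoc, ← mul_smul_comm, h', mul_smul_comm]

theorem IsCongruenceSimple.smul_eq_self (h : IsCongruenceSimple R)
    (hR : ∀ x y : R, x + y = 0 → x = 0) {p : R} (hp : p * p = p) (hp0 : p ≠ 0)
    {S : Type*} [CommSemiring S] [Module S R] [IsScalarTower S R R] [SMulCommClass S R R]
    {s : S} (hs : s • p ≠ 0) (x : R) : s • x = x := by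
  -- As `s • p ≠ 0`, the congruence `smulCon s` is not universal, hence is equality: `s` kills
  -- nothing but `0`, and `s • x` has the same nonzero multiples as `x`.
  have h0 : ∀ r : R, s • r = 0 → r = 0 := by
    intro r hr
    rcases h (smulCon s) with h | h
    · exact ringCon_eq_of_eq_bot h (show s • r = s • 0 by rw [hr, smul_zero])
    · have h1 : s • p = s • 0 := ringCon_rel_of_eq_top h p 0
      rw [smul_zero] at h1
      exact absurd h1 hs
  refine h.eq_of_annihilator hR hp hp0 fun u v => ?_
  rw [mul_smul_comm, smul_mul_assoc]
  exact ⟨h0 _, fun H => by rw [H, smul_zero]⟩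

end CongruenceSimple

/-! ### Branching systems and their representations on functions. -/

/-- A set with partial shift operators along which a graph acts: `y` has at most one first edge
`head y`, which can be removed by `tail`; an edge `e` can be put in front of `y` when its range is
`src y`; and only elements over vertices that are not regular may lack a first edge. -/
structure BranchingSystem {V E : Type*} (Γ : DirGraph V E) (Y : Type*) where
  src : Y → V
  head : Y → Option E
  tail : Y → Y
  cons : E → Y → Y
  src_eq {e y} : head y = some e → src y = Γ.s e
  src_tail {e y} : head y = some e → src (tail y) = Γ.r e
  cons_tail {e y} : head y = some e → cons e (tail y) = y
  head_cons {e y} : src y = Γ.r e → head (cons e y) = some e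
  tail_cons {e y} : src y = Γ.r e → tail (cons e y) = y
  not_isRegular {y} : head y = none → ¬ Γ.IsRegular (src y)

namespace BranchingSystem

open LeavittPath LeavittPathAlgebra Classical

variable {V E Y : Type*} {Γ : DirGraph V E} (B : BranchingSystem Γ Y) (S : Type*) [CommSemiring S]

/-- The action of the generators on functions. -/
noncomputable def genAct : Gen V E → Module.End S (Y → S)
  | .vertex v =>
    { toFun := fun φ y => if B.src y = v then φ y else 0
      map_add' := by intros; ext y; simp only [Pi.add_apply]; split_ifs <;> simp
      map_smul' := by intros; ext y; simp }
  | .edge e =>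
    { toFun := fun φ y => if B.head y = some e then φ (B.tail y) else 0
      map_add' := by intros; ext y; simp only [Pi.add_apply]; split_ifs <;> simp
      map_smul' := by intros; ext y; simp }
  | .ghost e =>
    { toFun := fun φ y => if B.src y = Γ.r e then φ (B.cons e y) else 0
      map_add' := by intros; ext y; simp only [Pi.add_apply]; split_ifs <;> simp
      map_smul' := by intros; ext y; simp }

theorem genAct_vertex (v : V) (φ : Y → S) (y : Y) :
    B.genAct S (.vertex v) φ y = if B.src y = v then φ y else 0 := rfl

theorem genAct_edge (e : E) (φ : Y → S) (y : Y) :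
    B.genAct S (.edge e) φ y = if B.head y = some e then φ (B.tail y) else 0 := rfl

theorem genAct_ghost (e : E) (φ : Y → S) (y : Y) :
    B.genAct S (.ghost e) φ y = if B.src y = Γ.r e then φ (B.cons e y) else 0 := rfl

/-- The action of the free algebra on functions. -/
noncomputable def freeAct : FreeAlg S V E →ₙₐ[S] Module.End S (Y → S) :=
  MonoidAlgebra.liftMagma S (FreeSemigroup.lift (B.genAct S))

theorem freeAct_single (g : Gen V E) :
    B.freeAct S (MonoidAlgebra.single (FreeSemigroup.of g) 1) = B.genAct S g := by
  simp [freeAct]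

theorem freeAct_rel {x y : FreeAlg S V E} (h : Rel S Γ x y) : B.freeAct S x = B.freeAct S y := by
  induction h with
  | vertex_idem v =>
    rw [map_mul, vtx, freeAct_single]
    ext1 φ; ext1 y
    simp only [Module.End.mul_apply, genAct_vertex]
    split_ifs <;> rfl
  | vertex_orth v w h =>
    rw [map_mul, vtx, vtx, freeAct_single, freeAct_single, map_zero]
    ext1 φ; ext1 y
    simp only [Module.End.mul_apply, genAct_vertex]
    split_ifs with h1 h2
    · exact absurd (h1.symm.trans h2) h
    · rfl
    · rfl
  | source_edge e =>
    rw [map_mul, vtx, edg, freeAct_single, freeAct_single]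
    ext1 φ; ext1 y
    simp only [Module.End.mul_apply, genAct_vertex, genAct_edge]
    split_ifs with h1 h2 h2
    · rfl
    · rfl
    · exact absurd (B.src_eq h2) h1
    · rfl
  | edge_range e =>
    rw [map_mul, vtx, edg, freeAct_single, freeAct_single]
    ext1 φ; ext1 y
    simp only [Module.End.mul_apply, genAct_vertex, genAct_edge]
    split_ifs with h1 h2
    · rfl
    · exact absurd (B.src_tail h1) h2
    · rfl
  | range_ghost e =>
    rw [map_mul, vtx, gst, freeAct_single, freeAct_single]
    ext1 φ; ext1 y
    simp only [Module.End.mul_apply, genAct_vertex, genAct_ghost]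
    split_ifs <;> rfl
  | ghost_source e =>
    rw [map_mul, vtx, gst, freeAct_single, freeAct_single]
    ext1 φ; ext1 y
    simp only [Module.End.mul_apply, genAct_vertex, genAct_ghost]
    split_ifs with h1 h2
    · rfl
    · exact absurd (B.src_eq (B.head_cons h1)) h2
    · rfl
  | ghost_edge_self e =>
    rw [map_mul, vtx, gst, edg, freeAct_single, freeAct_single, freeAct_single]
    ext1 φ; ext1 y
    simp only [Module.End.mul_apply, genAct_vertex, genAct_ghost, genAct_edge]
    split_ifs with h1 h2
    · rw [B.tail_cons h1]
    · exact absurd (B.head_cons h1) h2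
    · rfl
  | ghost_edge_ne e f h =>
    rw [map_mul, gst, edg, freeAct_single, freeAct_single, map_zero]
    ext1 φ; ext1 y
    simp only [Module.End.mul_apply, genAct_ghost, genAct_edge]
    split_ifs with h1 h2
    · rw [B.head_cons h1] at h2
      exact absurd (Option.some.inj h2) h
    · rfl
    · rfl
  | regular v h =>
    simp only [map_sum, map_mul, vtx, gst, edg, freeAct_single]
    ext1 φ; ext1 y
    simp only [LinearMap.sum_apply, Finset.sum_apply, Module.End.mul_apply, genAct_vertex,
      genAct_ghost, genAct_edge]
    cases hy : B.head y with
    | none =>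
      -- A point without a first edge is killed by every `e e*`, so it must not lie over the regular
      -- vertex `v`.
      rw [if_neg (fun hv : B.src y = v => B.not_isRegular hy (hv ▸ h))]
      exact (Finset.sum_eq_zero fun e _ => if_neg (by simp)).symm
    | some f =>
      have hf : B.src y = v ↔ f ∈ h.1.toFinset := by
        rw [Set.Finite.mem_toFinset, B.src_eq hy]; rfl
      have : ∀ e, (if some f = some e then
          if B.src (B.tail y) = Γ.r e then φ (B.cons e (B.tail y)) else 0 else 0) =
          if f = e then φ y else 0 := by
        intro e
        by_cases hfe : f = e
        · subst hfe
          rw [if_pos rfl, if_pos rfl, if_pos (B.src_tail hy), B.cons_tail hy]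
        · rw [if_neg hfe, if_neg (fun H => hfe (Option.some.inj H))]
      simp only [this, hf, Finset.sum_ite_eq]

theorem freeAct_conRel {x y : FreeAlg S V E} (h : ConRel S Γ x y) :
    B.freeAct S x = B.freeAct S y := by
  induction h with
  | of h => exact B.freeAct_rel S h
  | refl => rfl
  | symm _ ih => exact ih.symm
  | trans _ _ ih ih' => exact ih.trans ih'
  | add _ _ ih ih' => rw [map_add, map_add, ih, ih']
  | mul _ _ ih ih' => rw [map_mul, map_mul, ih, ih']
  | smul c _ ih => rw [map_smul, map_smul, ih]

/-- The action of the Leavitt path algebra on functions. -/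
noncomputable def act (x : LeavittPathAlgebra S Γ) : Module.End S (Y → S) :=
  Quotient.lift (s := (LeavittPath.con S Γ).toSetoid) (B.freeAct S)
    (fun _ _ h => B.freeAct_conRel S h) x

variable {S}

theorem act_mul (x y : LeavittPathAlgebra S Γ) : B.act S (x * y) = B.act S x * B.act S y := by
  induction x using Quotient.inductionOn
  induction y using Quotient.inductionOn
  exact map_mul (B.freeAct S) _ _

theorem act_add (x y : LeavittPathAlgebra S Γ) : B.act S (x + y) = B.act S x + B.act S y := by
  induction x using Quotient.inductionOn
  induction y using Quotient.inductionOn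
  exact map_add (B.freeAct S) _ _

theorem act_zero : B.act S (0 : LeavittPathAlgebra S Γ) = 0 := map_zero (B.freeAct S)

theorem act_smul (s : S) (x : LeavittPathAlgebra S Γ) : B.act S (s • x) = s • B.act S x := by
  induction x using Quotient.inductionOn
  exact map_smul (B.freeAct S) _ _

theorem act_vert (v : V) (φ : Y → S) (y : Y) :
    B.act S (vert S Γ v) φ y = if B.src y = v then φ y else 0 :=
  congrFun (LinearMap.congr_fun (B.freeAct_single S (.vertex v)) φ) y

theorem act_edge (e : E) (φ : Y → S) (y : Y) :
    B.act S (edge S Γ e) φ y = if B.head y = some e then φ (B.tail y) else 0 :=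
  congrFun (LinearMap.congr_fun (B.freeAct_single S (.edge e)) φ) y

theorem smul_vert_ne_zero (y : Y) {s : S} (hs : s ≠ 0) : s • vert S Γ (B.src y) ≠ 0 := by
  intro h
  have := congrFun (LinearMap.congr_fun (congrArg (B.act S) h) (fun _ => 1)) y
  rw [act_smul, act_zero, LinearMap.smul_apply, Pi.smul_apply, act_vert, if_pos rfl, smul_eq_mul,
    mul_one] at this
  exact hs this

/-- The congruence of acting in the same way. -/
def actCon (S : Type*) [CommSemiring S] : RingCon (LeavittPathAlgebra S Γ) where
  r x y := B.act S x = B.act S y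
  iseqv := ⟨fun _ => rfl, Eq.symm, Eq.trans⟩
  add' h h' := by rw [act_add, act_add, h, h']
  mul' h h' := by rw [act_mul, act_mul, h, h']

/-- The kernel congruence is not universal, because the vertex below a point of `Y` acts differently
from `0`. -/
theorem act_injective [Nontrivial S] (h : IsCongruenceSimple (LeavittPathAlgebra S Γ)) [Nonempty Y]
    {x x' : LeavittPathAlgebra S Γ} (hx : B.act S x = B.act S x') : x = x' := by
  rcases h (B.actCon S) with h | h
  · exact ringCon_eq_of_eq_bot h hx
  · obtain ⟨y⟩ := ‹Nonempty Y›
    have h1 : B.act S (vert S Γ (B.src y)) = B.act S 0 :=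
      ringCon_rel_of_eq_top h _ _
    have := congrFun (LinearMap.congr_fun h1 (fun _ => 1)) y
    rw [act_zero, act_vert, if_pos rfl] at this
    exact absurd this one_ne_zero

/-- The product of a branching system with `ℤ`, in which edges have degree `1`. -/
def prodInt : BranchingSystem Γ (Y × ℤ) where
  src y := B.src y.1
  head y := B.head y.1
  tail y := (B.tail y.1, y.2 - 1)
  cons e y := (B.cons e y.1, y.2 + 1)
  src_eq h := B.src_eq h
  src_tail h := B.src_tail h
  cons_tail h := by rw [B.cons_tail h, sub_add_cancel]
  head_cons h := B.head_cons h
  tail_cons h := by rw [B.tail_cons h, add_sub_cancel_right]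
  not_isRegular h := B.not_isRegular h

/-- Each edge lowers the degree at which `φ` is evaluated by one. -/
theorem prodInt_act_real (l : List E) (v : V) (φ : Y × ℤ → S) (n : ℤ)
    (hφ : ∀ y, φ (y, n - l.length) = 0) (y : Y) : B.prodInt.act S (real S Γ l v) φ (y, n) = 0 := by
  induction l generalizing n y with
  | nil =>
    rw [real_nil, act_vert, ite_eq_right_iff]
    simpa using fun _ => hφ y
  | cons e l ih =>
    rw [real_cons, act_mul, Module.End.mul_apply, act_edge, ite_eq_right_iff]
    refine fun _ => ih (n - 1) (fun y => ?_) _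
    rw [← hφ y, List.length_cons]
    congr 2
    push_cast
    ring

theorem real_ne_vert [Nontrivial S] (y : Y) {l : List E} (hl : l ≠ []) :
    real S Γ l (B.src y) ≠ vert S Γ (B.src y) := by
  intro h
  -- The test function is the indicator of degree `0`. At `(y, 0)` the vertex returns `1`, whereas
  -- `l` reads the function in degree `-l.length ≠ 0` and returns `0`.
  have h1 := congrFun (LinearMap.congr_fun (congrArg (B.prodInt.act S) h)
    (fun z => if z.2 = 0 then 1 else 0)) (y, 0)
  rw [act_vert, prodInt_act_real] at h1
  · exact zero_ne_one (h1.trans ((if_pos rfl).trans (if_pos rfl)))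
  · intro z
    refine if_neg ?_
    simpa using hl

end BranchingSystem

/-! ### Boundary paths and their branching system. -/

namespace DirGraph

variable {V E : Type*} (Γ : DirGraph V E)

/-- Every vertex that can be reached from `w` emits exactly one edge. -/
def Unbranched (w : V) : Prop := ∀ t v, Γ.IsPath w t v → ∃! e, Γ.s e = v

variable {Γ} in
theorem isRegular_of_existsUnique {v : V} (h : ∃! e, Γ.s e = v) : Γ.IsRegular v := by
  obtain ⟨e, he, h⟩ := h
  exact ⟨Set.Subsingleton.finite fun a ha b hb => (h a ha).trans (h b hb).symm, e, he⟩

/-- The source of an edge, a vertex being its own source. -/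
def arrowSrc : E ⊕ V → V := Sum.elim Γ.s id

/-- An edge is followed by an edge or a vertex at its range; a vertex that is not regular is
followed by itself, and any other vertex by nothing. -/
def Follows : E ⊕ V → E ⊕ V → Prop
  | .inl e, y => Γ.arrowSrc y = Γ.r e
  | .inr v, y => y = .inr v ∧ ¬ Γ.IsRegular v

/-- The boundary paths that avoid `H`: the infinite paths, and the finite paths that end in a
vertex that is not regular, written as sequences that repeat this vertex forever. -/
def BoundaryPath (H : Set V) :=
  {x : ℕ → E ⊕ V // ∀ n, Γ.arrowSrc (x n) ∉ H ∧ Γ.Follows (x n) (x (n + 1))}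

variable {Γ} {H : Set V}

/-- Saturation lets a path continue outside `H` from any regular vertex outside `H`; at other
vertices it may stop. -/
theorem exists_boundaryPath (hsat : ∀ v, Γ.IsRegular v → (∀ e, Γ.s e = v → Γ.r e ∈ H) → v ∈ H)
    {v : V} (hv : v ∉ H) : ∃ x : Γ.BoundaryPath H, Γ.arrowSrc (x.1 0) = v := by
  classical
  have hstep : ∀ v : V, ∃ a : E ⊕ V, Γ.arrowSrc a = v ∧ (v ∉ H →
      (∀ e, a = .inl e → Γ.r e ∉ H) ∧ ∀ w, a = .inr w → ¬ Γ.IsRegular w) := by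
    intro v
    by_cases hr : Γ.IsRegular v
    · by_cases hv : v ∈ H
      · exact ⟨.inr v, rfl, fun h => absurd hv h⟩
      · have : ∃ e, Γ.s e = v ∧ Γ.r e ∉ H := by
          by_contra hne
          push Not at hne
          exact hv (hsat v hr hne)
        obtain ⟨e, he, he'⟩ := this
        refine ⟨.inl e, he, fun _ => ⟨?_, ?_⟩⟩
        · rintro f hf; cases hf; exact he'
        · rintro w ⟨⟩
    · refine ⟨.inr v, rfl, fun _ => ⟨?_, ?_⟩⟩
      · rintro e ⟨⟩
      · rintro w hw; cases hw; exact hr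
  choose a ha ha' using hstep
  let next : E ⊕ V → E ⊕ V := Sum.elim (fun e => a (Γ.r e)) Sum.inr
  let x : ℕ → E ⊕ V := fun n => next^[n] (a v)
  have hx : ∀ n, x (n + 1) = next (x n) := fun n => Function.iterate_succ_apply' _ _ _
  have hP : ∀ n, Γ.arrowSrc (x n) ∉ H ∧ (∀ e, x n = .inl e → Γ.r e ∉ H) ∧
      ∀ w, x n = .inr w → ¬ Γ.IsRegular w := by
    intro n
    induction n with
    | zero => exact ⟨by rw [show x 0 = a v from rfl, ha]; exact hv, ha' v hv⟩
    | succ n ih =>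
      rw [hx]
      rcases hn : x n with e | w
      · have he := ih.2.1 e hn
        exact ⟨by rw [show next (.inl e) = a (Γ.r e) from rfl, ha]; exact he, ha' _ he⟩
      · rw [hn] at ih
        exact ih
  refine ⟨⟨x, fun n => ⟨(hP n).1, ?_⟩⟩, ha v⟩
  rw [hx]
  rcases hn : x n with e | w
  · exact ha _
  · exact ⟨rfl, (hP n).2.2 w hn⟩

namespace BoundaryPath

theorem eq_inl (x : Γ.BoundaryPath H) (n : ℕ) (h : ∃! e, Γ.s e = Γ.arrowSrc (x.1 n)) {e : E}
    (he : Γ.s e = Γ.arrowSrc (x.1 n)) : x.1 n = .inl e := by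
  rcases hn : x.1 n with f | v
  · rw [hn] at h he
    rw [h.unique he rfl]
  · have := (x.2 n).2
    rw [hn] at this h
    -- A vertex that emits exactly one edge is regular, so a boundary path cannot stop there.
    exact absurd (isRegular_of_existsUnique h) this.2

theorem eq_of_unbranched {x y : Γ.BoundaryPath H} (h : Γ.Unbranched (Γ.arrowSrc (x.1 0)))
    (hxy : Γ.arrowSrc (x.1 0) = Γ.arrowSrc (y.1 0)) : x = y := by
  -- The path `t` is carried along because `Unbranched` speaks only of vertices reachable from the
  -- start.
  have key : ∀ n, x.1 n = y.1 n ∧ ∃ t, Γ.IsPath (Γ.arrowSrc (x.1 0)) t (Γ.arrowSrc (x.1 n)) := by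
    intro n
    have main : ∀ n t, Γ.IsPath (Γ.arrowSrc (x.1 0)) t (Γ.arrowSrc (x.1 n)) →
        Γ.arrowSrc (x.1 n) = Γ.arrowSrc (y.1 n) → ∃ e, x.1 n = .inl e ∧ y.1 n = .inl e := by
      intro n t ht hn
      have hu := h t _ ht
      obtain ⟨e, he, -⟩ := id hu
      exact ⟨e, x.eq_inl n hu he, y.eq_inl n (hn ▸ hu) (hn ▸ he)⟩
    induction n with
    | zero =>
      obtain ⟨e, he, he'⟩ := main 0 [] rfl hxy
      exact ⟨he.trans he'.symm, [], rfl⟩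
    | succ n ih =>
      obtain ⟨ih, t, ht⟩ := ih
      obtain ⟨e, he, he'⟩ := main n t ht (by rw [ih])
      have hx := (x.2 n).2
      have hy := (y.2 n).2
      rw [he] at hx ht
      rw [he'] at hy
      have ht' : Γ.IsPath (Γ.arrowSrc (x.1 0)) (t ++ [e]) (Γ.arrowSrc (x.1 (n + 1))) :=
        ht.append ⟨rfl, Eq.symm hx⟩
      obtain ⟨f, hf, hf'⟩ := main (n + 1) _ ht' (Eq.trans hx (Eq.symm hy))
      exact ⟨hf.trans hf'.symm, _, ht'⟩
  exact Subtype.ext (funext fun n => (key n).1)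

/-- Removing the first edge. -/
def tail (x : Γ.BoundaryPath H) : Γ.BoundaryPath H := ⟨fun n => x.1 (n + 1), fun n => x.2 (n + 1)⟩

/-- Putting an edge in front. -/
def cons (hH : ∀ e, Γ.s e ∈ H → Γ.r e ∈ H) (e : E) (x : Γ.BoundaryPath H)
    (h : Γ.arrowSrc (x.1 0) = Γ.r e) : Γ.BoundaryPath H :=
  ⟨fun n => Nat.casesOn n (.inl e) x.1, fun n => by
    cases n with
    | zero => exact ⟨fun he => (x.2 0).1 (h ▸ hH e he), h⟩
    | succ n => exact x.2 n⟩

theorem follows_of_head {x : Γ.BoundaryPath H} {e : E} (h : (x.1 0).getLeft? = some e) :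
    x.1 0 = .inl e ∧ Γ.arrowSrc (x.1 1) = Γ.r e := by
  have h0 := Sum.getLeft?_eq_some_iff.1 h
  have := (x.2 0).2
  rw [h0] at this
  exact ⟨h0, this⟩

open Classical in
/-- The branching system of the boundary paths that avoid a hereditary set. -/
noncomputable def branchingSystem (hH : ∀ e, Γ.s e ∈ H → Γ.r e ∈ H) :
    BranchingSystem Γ (Γ.BoundaryPath H) where
  src x := Γ.arrowSrc (x.1 0)
  head x := (x.1 0).getLeft?
  tail := tail
  cons e x := if h : Γ.arrowSrc (x.1 0) = Γ.r e then cons hH e x h else x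
  src_eq h := by rw [(follows_of_head h).1]; rfl
  src_tail h := (follows_of_head h).2
  cons_tail {e x} h := by
    have h1 := follows_of_head h
    rw [dif_pos (show Γ.arrowSrc (x.tail.1 0) = Γ.r e from h1.2)]
    apply Subtype.ext
    funext n
    cases n with
    | zero => exact h1.1.symm
    | succ n => rfl
  head_cons h := by rw [dif_pos h]; rfl
  tail_cons h := by rw [dif_pos h]; rfl
  not_isRegular {x} h := by
    rcases h0 : x.1 0 with e | v
    · rw [h0] at h; cases h
    · have := (x.2 0).2
      rw [h0] at this
      exact this.2

end BoundaryPath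

end DirGraph

/-! ### From a nonzero element of an ideal to a vertex. -/

open LeavittPathAlgebra

namespace BranchingSystem

variable {V E Y S : Type*} [CommSemiring S] {Γ : DirGraph V E} (B : BranchingSystem Γ Y)

theorem act_real_of_unbranched {u v : V} {l : List E} (hl : Γ.IsPath u l v) (hu : Γ.Unbranched u)
    {y : Y} (hy : B.src y = u) : B.src (B.tail^[l.length] y) = v ∧
      ∀ φ : Y → S, B.act S (real S Γ l v) φ y = φ (B.tail^[l.length] y) := by
  induction l generalizing u y with
  | nil =>
    cases hl
    exact ⟨hy, fun φ => by rw [real_nil, act_vert, if_pos hy]; rfl⟩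
  | cons e l ih =>
    have hue := hu [] u rfl
    have hhead : B.head y = some e := by
      cases h : B.head y with
      | none =>
        exact absurd (hy ▸ DirGraph.isRegular_of_existsUnique hue) (B.not_isRegular h)
      | some f => rw [hue.unique hl.1 ((B.src_eq h).symm.trans hy)]
    obtain ⟨h1, h2⟩ := ih hl.2 (fun t v ht => hu (e :: t) v ⟨hl.1, ht⟩) (B.src_tail hhead)
    refine ⟨h1, fun φ => ?_⟩
    rw [real_cons, act_mul, Module.End.mul_apply, act_edge, if_pos hhead, h2]
    rfl

end BranchingSystem

/-- Used to drop the vanishing terms of a sum after a multiplication; the length bound drives the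
induction in `exists_vert_mem_of_add_sum_mem`. -/
theorem List.exists_map_sum_eq {α β M : Type*} [AddMonoid M] {f : α → M} {g : β → M}
    {P : β → Prop} (L : List α) (h : ∀ a ∈ L, f a = 0 ∨ ∃ b, P b ∧ f a = g b) :
    ∃ L' : List β, L'.length ≤ L.length ∧ (∀ b ∈ L', P b) ∧
      (L.map f).sum = (L'.map g).sum := by
  induction L with
  | nil => exact ⟨[], le_rfl, by simp, rfl⟩
  | cons a L ih =>
    obtain ⟨L', h1, h2, h3⟩ := ih fun b hb => h b (List.mem_cons_of_mem _ hb)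
    rcases h a List.mem_cons_self with ha | ⟨b, hb, ha⟩
    · exact ⟨L', h1.trans (Nat.le_succ _), h2, by rw [map_cons, sum_cons, ha, zero_add, h3]⟩
    · refine ⟨b :: L', Nat.succ_le_succ h1, ?_, by simp [ha, h3]⟩
      simpa using ⟨hb, h2⟩

theorem List.exists_map_sum_eq_add {α M : Type*} [AddCommMonoid M] (f : α → M) {L : List α} {b : α}
    (hb : b ∈ L) :
    ∃ L' : List α, (∀ x ∈ L', x ∈ L) ∧ (L.map f).sum = f b + (L'.map f).sum := by
  classical
  exact ⟨L.erase b, fun _ => List.mem_of_mem_erase, (List.sum_map_erase f hb).symm⟩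

namespace LeavittPathAlgebra

variable {V E S : Type*} [CommSemiring S] {Γ : DirGraph V E}

/-- If some vertex reachable from `w` does not emit exactly one edge, `t` can be chosen to leave the
route of `c`. Otherwise there is only one boundary path from `w`; `c` then acts as `w`, contrary to
`real_ne_vert`. -/
theorem exists_imag_mul_real_mul_real_eq_zero [Nontrivial S]
    (h : IsCongruenceSimple (LeavittPathAlgebra S Γ)) {w : V} {c : List E}
    (hc : Γ.IsPath w c w) (hc0 : c ≠ []) :
    ∃ t v, Γ.IsPath w t v ∧ imag S Γ t v * real S Γ c w * real S Γ t v = 0 := by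
  by_cases hw : Γ.Unbranched w
  · let B := DirGraph.BoundaryPath.branchingSystem (Γ := Γ) (H := ∅) (by simp)
    obtain ⟨x, hx⟩ := DirGraph.exists_boundaryPath (Γ := Γ) (H := ∅)
      (fun v hv he => by
        obtain ⟨e, hev⟩ := hv.2
        exact he e hev) (Set.notMem_empty w)
    have : Nonempty (Γ.BoundaryPath ∅) := ⟨x⟩
    refine absurd (B.act_injective (S := S) h (x := real S Γ c w) (x' := vert S Γ w) ?_) ?_
    swap
    · have := B.real_ne_vert (S := S) x hc0
      rwa [show B.src x = w from hx] at this
    ext1 φ; ext1 y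
    rw [BranchingSystem.act_vert]
    by_cases hy : B.src y = w
    · obtain ⟨h1, h2⟩ := B.act_real_of_unbranched (S := S) hc hw hy
      rw [if_pos hy, h2, DirGraph.BoundaryPath.eq_of_unbranched (y := y) 
        (show Γ.Unbranched (B.src (B.tail^[c.length] y)) from h1.symm ▸ hw)
        (h1.trans hy.symm)]
    · rw [if_neg hy, ← vert_mul_real hc, BranchingSystem.act_mul, Module.End.mul_apply,
        BranchingSystem.act_vert, if_neg hy]
  · unfold DirGraph.Unbranched at hw
    push Not at hw
    obtain ⟨t, v, ht, hv⟩ := hw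
    rcases imag_mul_real (S := S) ht (hc.append ht) (by simp) with h0 | ⟨d, hd, hdv, h0⟩
    · exact ⟨t, v, ht, by rw [mul_assoc, real_mul_real c ht, h0]⟩
    · cases d with
      | nil =>
        have := congrArg List.length hd
        simp [hc0] at this
      | cons f d =>
        have : ∃ e, Γ.s e = v ∧ e ≠ f := by
          by_contra hne
          push Not at hne
          exact hv ⟨f, hdv.1, hne⟩
        obtain ⟨e, rfl, hef⟩ := this
        -- Here `t* c t` is a path with first edge `f ≠ e`, so a further `e*` on the left kills it.
        refine ⟨t ++ [e], Γ.r e, ht.append ⟨rfl, rfl⟩, ?_⟩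
        have he : real S Γ (t ++ [e]) (Γ.r e) = real S Γ t (Γ.s e) * edge S Γ e := by
          rw [← real_mul_real t (v := Γ.s e) (show Γ.IsPath _ [e] _ from ⟨rfl, rfl⟩), real_cons, real_nil, edge_mul_range]
        rw [← ghost_mul_imag, he, mul_assoc, mul_assoc, ← mul_assoc (real S Γ c w),
          real_mul_real c ht, ← mul_assoc (imag S Γ t _), h0, real_cons, ← mul_assoc, ← mul_assoc,
          ghost_mul_edge_ne hef, zero_mul, zero_mul]

variable {I : AddSubmonoid (LeavittPathAlgebra S Γ)}

/-- Conjugation by `t` turns `w` into the end `v` of `t`, kills `c`, and sends each other closed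
path to `0` or to a closed path at `v` of the same length. So the number of closed paths drops. -/
theorem exists_vert_mem_of_add_sum_mem
    (hexit : ∀ w c, Γ.IsPath w c w → c ≠ [] →
      ∃ t v, Γ.IsPath w t v ∧ imag S Γ t v * real S Γ c w * real S Γ t v = 0)
    (hI : ∀ a ∈ I, ∀ x, x * a ∈ I ∧ a * x ∈ I) (n : ℕ) (w : V) (D : List (List E))
    (hn : D.length ≤ n) (hD : ∀ d ∈ D, Γ.IsPath w d w ∧ d ≠ [])
    (hmem : vert S Γ w + (D.map (real S Γ · w)).sum ∈ I) : ∃ v, vert S Γ v ∈ I := by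
  induction n generalizing w D with
  | zero =>
    rw [List.length_eq_zero_iff.1 (Nat.le_zero.1 hn)] at hmem
    exact ⟨w, by simpa using hmem⟩
  | succ n ih =>
    cases D with
    | nil => exact ⟨w, by simpa using hmem⟩
    | cons c D =>
      obtain ⟨hc, hD⟩ := List.forall_mem_cons.1 hD
      obtain ⟨t, v, ht, h0⟩ := hexit w c hc.1 hc.2
      have h1 := (hI _ (hI _ hmem (imag S Γ t v)).1 (real S Γ t v)).2
      rw [mul_add, add_mul, imag_mul_vert ht, imag_mul_real_self ht, List.map_cons, List.sum_cons,
        mul_add, add_mul, h0, zero_add, ← List.sum_map_mul_left, ← List.sum_map_mul_right] at h1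
      obtain ⟨D', hl, hD', hsum⟩ := List.exists_map_sum_eq (g := (real S Γ · v))
        (P := fun d => Γ.IsPath v d v ∧ d ≠ [])
        (f := fun d => imag S Γ t v * real S Γ d w * real S Γ t v) D (by
          intro d hd
          rw [mul_assoc, real_mul_real d ht]
          refine (imag_mul_real ht ((hD d hd).1.append ht) (by simp)).imp_right ?_
          rintro ⟨d', e, h2, h3⟩
          refine ⟨d', ⟨h2, ?_⟩, h3⟩
          rintro rfl
          have := congrArg List.length e
          simp [(hD d hd).2] at this)
      rw [hsum] at h1
      exact ih v D' (hl.trans (Nat.succ_le_succ_iff.1 hn)) hD' h1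

theorem exists_closed_paths_mem (hI : ∀ a ∈ I, ∀ x, x * a ∈ I ∧ a * x ∈ I)
    (hadd : ∀ x : LeavittPathAlgebra S Γ, x + x = x)
    (hspan : AddSubmonoid.closure (monomials S Γ) = ⊤) {a : LeavittPathAlgebra S Γ} (ha : a ∈ I)
    (ha0 : a ≠ 0) : ∃ (w : V) (D : List (List E)), (∀ d ∈ D, Γ.IsPath w d w ∧ d ≠ []) ∧
      vert S Γ w + (D.map (real S Γ · w)).sum ∈ I := by
  classical
  obtain ⟨l, hl, hla⟩ := AddSubmonoid.exists_list_of_mem_closure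
    (hspan ▸ AddSubmonoid.mem_top a : a ∈ AddSubmonoid.closure (monomials S Γ))
  obtain ⟨L, -, hL, hsum⟩ := List.exists_map_sum_eq (f := id)
    (g := fun b : List E × V × List E => real S Γ b.1 b.2.1 * imag S Γ b.2.2 b.2.1)
    (P := fun b => ∃ u u', Γ.IsPath u b.1 b.2.1 ∧ Γ.IsPath u' b.2.2 b.2.1) l (by
      intro x hx
      obtain ⟨u, u', v, p, q, hp, hq, rfl⟩ := hl x hx
      exact .inr ⟨(p, v, q), ⟨u, u', hp, hq⟩, rfl⟩)
  rw [List.map_id, hla] at hsum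
  have hne : L.toFinset.Nonempty := by
    rw [List.toFinset_nonempty_iff]
    rintro rfl
    exact ha0 hsum
  -- With `q` a longest ghost part, right multiplication by `q` leaves no ghost edges and turns `p
  -- q*` into `p`.
  obtain ⟨⟨p, v, q⟩, hb, hmax⟩ := Finset.exists_max_image _ (fun b => b.2.2.length) hne
  rw [List.mem_toFinset] at hb
  obtain ⟨u, u', hp, hq⟩ := hL _ hb
  obtain ⟨L₀, hL₀, hsum₀⟩ := List.exists_map_sum_eq_add
    (fun b : List E × V × List E => real S Γ b.1 b.2.1 * imag S Γ b.2.2 b.2.1) hb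
  have h1 := (hI a ha (real S Γ q v)).2
  rw [hsum, hsum₀, add_mul, mul_assoc, imag_mul_real_self hq, real_mul_vert,
    ← List.sum_map_mul_right] at h1
  obtain ⟨L', -, hL', hsum'⟩ := List.exists_map_sum_eq
    (f := fun b : List E × V × List E =>
      real S Γ b.1 b.2.1 * imag S Γ b.2.2 b.2.1 * real S Γ q v)
    (g := (real S Γ · v)) (P := fun d => ∃ u, Γ.IsPath u d v) L₀ (by
      rintro ⟨p', v', q'⟩ hb'
      have hb' := hL₀ _ hb'
      obtain ⟨x, x', hp', hq'⟩ := hL _ hb'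
      rw [mul_assoc]
      rcases imag_mul_real (S := S) hq' hq (hmax _ (List.mem_toFinset.2 hb')) with h | ⟨d, -, hd, h⟩
      · exact .inl (by rw [h, mul_zero])
      · exact .inr ⟨p' ++ d, ⟨x, hp'.append hd⟩, by rw [h, real_mul_real p' hd]⟩)
  rw [hsum', ← List.sum_cons, ← List.map_cons (f := (real S Γ · v))] at h1
  have hL1 : ∀ d ∈ p :: L', ∃ u, Γ.IsPath u d v := List.forall_mem_cons.2 ⟨⟨u, hp⟩, hL'⟩
  -- With `p'` shortest, left multiplication by `p'*` turns `p'` into `v` and every other term into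
  -- `0` or a closed path at `v`.
  obtain ⟨p', hp', hmin⟩ := Finset.exists_min_image (p :: L').toFinset List.length
    ⟨p, by simp⟩
  rw [List.mem_toFinset] at hp'
  obtain ⟨x, hx⟩ := hL1 p' hp'
  obtain ⟨L₁, hL₁, hsum₁⟩ := List.exists_map_sum_eq_add (real S Γ · v) hp'
  have h2 := (hI _ h1 (imag S Γ p' v)).1
  rw [hsum₁, mul_add, imag_mul_real_self hx, ← List.sum_map_mul_left] at h2
  obtain ⟨D, -, hD, hsum2⟩ := List.exists_map_sum_eq
    (f := fun d => imag S Γ p' v * real S Γ d v) (g := (real S Γ · v))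
    (P := fun d => Γ.IsPath v d v) L₁ (by
      intro d hd
      have hd := hL₁ _ hd
      obtain ⟨y, hy⟩ := hL1 d hd
      refine (imag_mul_real hx hy (hmin d (List.mem_toFinset.2 hd))).imp_right ?_
      rintro ⟨d', -, h⟩
      exact ⟨d', h⟩)
  rw [hsum2] at h2
  -- Empty paths contribute further copies of `v`, which idempotent addition absorbs.
  refine ⟨v, D.filter (· ≠ []), fun d hd => ?_, ?_⟩
  · rw [List.mem_filter] at hd
    exact ⟨hD d hd.1, by simpa using hd.2⟩
  · convert h2 using 1
    clear hD hsum2 h2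
    induction D with
    | nil => rfl
    | cons d D ih =>
      by_cases hd : d = []
      · subst hd
        rw [List.filter_cons_of_neg (by simp), ih, List.map_cons, List.sum_cons, real_nil,
          ← add_assoc, hadd]
      · rw [List.filter_cons_of_pos (by simpa using hd), List.map_cons, List.sum_cons,
          List.map_cons, List.sum_cons, add_left_comm, ih, add_left_comm]

/-! ### From vertices to the whole algebra. -/

theorem eq_top_of_forall_vert_mem (hI : ∀ a ∈ I, ∀ x, x * a ∈ I ∧ a * x ∈ I)
    (h : ∀ v, vert S Γ v ∈ I) : I = ⊤ := by
  refine eq_top_iff.2 fun x _ => ?_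
  have hx : x ∈ Submodule.span S (monomials S Γ) := by
    rw [span_monomials]; trivial
  -- Ideals are not assumed closed under scalars, so the induction carries all scalar multiples; on
  -- a monomial the scalar is absorbed into the factor `p`.
  suffices ∀ s : S, s • x ∈ I by simpa using this 1
  induction hx using Submodule.span_induction with
  | mem x hx =>
    obtain ⟨u, u', v, p, q, hp, hq, rfl⟩ := hx
    intro s
    rw [← vert_mul_imag q v, ← smul_mul_assoc]
    exact (hI _ (hI _ (h v) _).2 _).1
  | zero => intro s; rw [smul_zero]; exact I.zero_mem
  | add x y _ _ hx hy => intro s; rw [smul_add]; exact add_mem (hx trivial s) (hy trivial s)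
  | smul c x _ hx => intro s; rw [smul_smul]; exact hx trivial _

theorem closure_monomials (h : ∀ (s : S) (x : LeavittPathAlgebra S Γ), s ≠ 0 → s • x = x) :
    AddSubmonoid.closure (monomials S Γ) = ⊤ := by
  refine eq_top_iff.2 fun x _ => ?_
  have hx : x ∈ Submodule.span S (monomials S Γ) := by
    rw [span_monomials]; trivial
  induction hx using Submodule.span_induction with
  | mem x hx => exact AddSubmonoid.subset_closure hx
  | zero => exact zero_mem _
  | add x y _ _ hx hy => exact add_mem (hx trivial) (hy trivial)
  | smul c x _ hx =>
    by_cases hc : c = 0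
    · rw [hc, zero_smul]; exact zero_mem _
    · rw [h c x hc]; exact hx trivial

theorem smul_vert_ne_zero (v : V) {s : S} (hs : s ≠ 0) : s • vert S Γ v ≠ 0 := by
  obtain ⟨x, rfl⟩ := DirGraph.exists_boundaryPath (Γ := Γ) (H := ∅)
    (fun v hv he => by
      obtain ⟨e, hev⟩ := hv.2
      exact he e hev) (Set.notMem_empty v)
  exact (DirGraph.BoundaryPath.branchingSystem (Γ := Γ) (H := ∅) (by simp)).smul_vert_ne_zero x hs

/-- The vertices in `I` form a hereditary saturated set `H`. Were some vertex outside `H`, the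
boundary paths avoiding `H` would carry a faithful action in which the nonzero element `w` acts as
`0`. -/
theorem forall_vert_mem [Nontrivial S] (h : IsCongruenceSimple (LeavittPathAlgebra S Γ))
    (hI : ∀ a ∈ I, ∀ x, x * a ∈ I ∧ a * x ∈ I) {w : V} (hw : vert S Γ w ∈ I) (v : V) :
    vert S Γ v ∈ I := by
  by_contra hv
  let H : Set V := {v | vert S Γ v ∈ I}
  have hher : ∀ e, Γ.s e ∈ H → Γ.r e ∈ H := by
    intro e he
    have := (hI _ (hI _ he (ghost S Γ e)).1 (edge S Γ e)).2
    rwa [ghost_mul_source, ghost_mul_edge_self] at this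
  have hsat : ∀ v, Γ.IsRegular v → (∀ e, Γ.s e = v → Γ.r e ∈ H) → v ∈ H := by
    intro v hreg he
    change vert S Γ v ∈ I
    rw [vert_eq_sum hreg]
    refine sum_mem fun e hes => ?_
    rw [← edge_mul_range]
    exact (hI _ (hI _ (he e (hreg.1.mem_toFinset.1 hes)) _).1 _).2
  obtain ⟨x, -⟩ := DirGraph.exists_boundaryPath hsat (show v ∉ H from hv)
  have : Nonempty (Γ.BoundaryPath H) := ⟨x⟩
  let B := DirGraph.BoundaryPath.branchingSystem hher
  have hw0 : vert S Γ w ≠ 0 := by simpa using smul_vert_ne_zero (Γ := Γ) w (one_ne_zero' S)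
  refine hw0 (B.act_injective h ?_)
  ext1 φ; ext1 y
  rw [BranchingSystem.act_zero, BranchingSystem.act_vert, if_neg]
  · rfl
  · intro hy
    exact (y.2 0).1 (show Γ.arrowSrc (y.1 0) ∈ H from (show Γ.arrowSrc (y.1 0) = w from hy) ▸ hw)

end LeavittPathAlgebra

theorem corollary4p2 {V E S : Type*} [CommSemiring S] (Γ : DirGraph V E)
    (h : IsCongruenceSimple (LeavittPathAlgebra S Γ)) :
    IsIdealSimple (LeavittPathAlgebra S Γ) := by
  intro I hI
  refine or_iff_not_imp_left.2 fun hbot => eq_top_of_forall_vert_mem hI fun v => ?_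
  obtain ⟨a, ha, ha0⟩ := I.bot_or_exists_ne_zero.resolve_left hbot
  have : Nontrivial S := by
    by_contra hS
    rw [not_nontrivial_iff_subsingleton] at hS
    exact ha0 (by rw [← one_smul S a, Subsingleton.elim (1 : S) 0, zero_smul])
  have hv0 : vert S Γ v ≠ 0 := by simpa using smul_vert_ne_zero (Γ := Γ) v (one_ne_zero' S)
  rcases h.zeroSumFree_or_exists_neg with hR | hR
  · have hadd := h.add_self hR (vert_mul_self v) hv0
    have hspan := closure_monomials fun s x hs =>
      h.smul_eq_self hR (vert_mul_self v) hv0 (smul_vert_ne_zero v hs) x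
    obtain ⟨w, D, hD, hmem⟩ := exists_closed_paths_mem hI hadd hspan ha ha0
    obtain ⟨w, hw⟩ := exists_vert_mem_of_add_sum_mem
      (fun w c hc hc0 => exists_imag_mul_real_mul_real_eq_zero h hc hc0) hI _ w D le_rfl hD hmem
    exact forall_vert_mem h hI hw v
  · obtain ⟨b, hb, c, hc, hbc⟩ := h.exists_add_eq hI ha ha0 (vert S Γ v)
    obtain ⟨v', hv'⟩ := hR (vert S Γ v)
    -- With `c = v + b` and `v' = -v`, the right side is `v (v + b) - v b = v`.
    have key : vert S Γ v = vert S Γ v * c + v' * b := by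
      rw [← hbc, mul_add, vert_mul_self, add_assoc, ← add_mul, hv', zero_mul, add_zero]
    rw [key]
    exact add_mem (hI _ hc _).1 (hI _ hb _).1
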